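/- A signed hypergraph is a pair $H=(V,S)$ with $V$ a finite set of nodes and $S$ a finite set of pairwise distinct signed edges; a signed edge is a pair $s=(e,\eta_s)$ with $e\subseteq V$, $|e|\ge 2$ (the underlying edge of $s$), and $\eta_s:e\to\{-1,+1\}$. The pseudo-Boolean polytope $\mathrm{PBP}(H)\subseteq\mathbb R^{V\cup S}$ is the convex hull of $$\Big\{z\in\{0,1\}^{V\cup S}: z_s=\prod_{v\in e:\,\eta_s(v)=+1}z_v\prod_{v\in e:\,\eta_s(v)=-1}(1-z_v)\ \ \forall s=(e,\eta_s)\in S\Big\}.$$ Let $V=\{v_1,\dots,v_n\}$ with $n=|V|\geq 2$, and put $e_k:=\{v_1,\dots,v_{k+1}\}$ for $k\in\{1,\dots,n-1\}$. For $s$ with underlying edge $e_k$, let $\ell(s)$ be obtained from $s$ by flipping the sign of $v_{k+1}$, and let $p(s)$ be obtained from $s$ by deleting $v_{k+1}$ (the remaining nodes keep their signs). $H$ is a nested signed hypergraph if the set of underlying edges of $S$ is exactly $\{e_1,\dots,e_{n-1}\}$, and for every $s\in S$ with underlying edge $e_k$ we have $\ell(s)\in S$ and, if $k\ge 2$, also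 $p(s)\in S$. Let $\mathcal E_k$ be the set of signed edges in $S$ with underlying edge $e_k$, and for $k \geq 2$ let $\mathcal E_k^{+}$ and $\mathcal E_k^-$ be the sets of those $s\in\mathcal E_k$ with $\eta_s(v_{k+1})=+1$ and $\eta_s(v_{k+1})=-1$, respectively. **Proposition.** Let $H=(V,S)$ be a nested signed hypergraph, and suppose that $\mathcal E_1=\{q_1,q_2,q_3,q_4\}$, where the signs of $(v_1,v_2)$ are $(+1,+1)$ in $q_1$, $(+1,-1)$ in $q_2$, $(-1,+1)$ in $q_3$ and $(-1,-1)$ in $q_4$. Then $\mathrm{PBP}(H)$ is the set of all $z\in\mathbb R^{V\cup S}$ that satisfy \begin{align*} & z_s+z_{\ell(s)}=z_{p(s)} && \forall s\in\mathcal E_k^+,\ k\in\{2,\dots,n-1\},\\ & z_s\ge 0 && \forall s\in S,\\ & \sum_{s\in\mathcal E_k^+}z_s\le z_{v_{k+1}} && \forall k\in\{2,\dots,n-1\},\\ & \sum_{s\in\mathcal E_k^-}z_s\le 1-z_{v_{k+1}} && \forall k\in\{2,\dots,n-1\},\\ & z_{q_1}+z_{q_2}=z_{v_1},\quad z_{q_1}+z_{q_3}=z_{v_2},\quad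 z_{q_3}+z_{q_4}=1-z_{v_1}. \end{align*} -/

import Mathlib

/-- A signed edge on the node set `V`: a finite set `nodes` of nodes (the underlying edge) together
with a map that assigns to each of these nodes a sign in `{-1, +1}`. The requirement that the edges
of a signed hypergraph have at least two nodes is part of `SignedHypergraph`. -/
@[ext]
structure SignedEdge (V : Type*) where
  nodes : Finset V
  sign : {u // u ∈ nodes} → ℤˣ

namespace SignedEdge

variable {V : Type*}

/-- The node `u` belongs to `s`, and its sign in `s` is `ε`. -/
def HasSign (s : SignedEdge V) (u : V) (ε : ℤˣ) : Prop :=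
  ∃ h : u ∈ s.nodes, s.sign ⟨u, h⟩ = ε

instance [DecidableEq V] (s : SignedEdge V) (u : V) (ε : ℤˣ) : Decidable (s.HasSign u ε) :=
  inferInstanceAs (Decidable (∃ h : u ∈ s.nodes, s.sign ⟨u, h⟩ = ε))

/-- The signed edge obtained from `s` by flipping the sign of the node `u`. -/
def flip [DecidableEq V] (s : SignedEdge V) (u : V) : SignedEdge V where
  nodes := s.nodes
  sign w := if w.1 = u then -s.sign w else s.sign w

/-- The signed edge `s - u`: the node `u` is removed, and all other nodes keep their signs. -/
def erase [DecidableEq V] (s : SignedEdge V) (u : V) : SignedEdge V where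
  nodes := s.nodes.erase u
  sign w := s.sign ⟨w.1, Finset.mem_of_mem_erase w.2⟩

/-- The literal `σ` of a node with sign `ε` and value `x`: `x` if `ε = +1`, and `1 - x` if
`ε = -1`. -/
def literal (ε : ℤˣ) (x : ℝ) : ℝ := if ε = 1 then x else 1 - x

end SignedEdge

/-- A signed hypergraph on the node set `V`: a finite set of signed edges (so no two of them are
identical), each with at least two nodes. -/
structure SignedHypergraph (V : Type*) where
  edges : Finset (SignedEdge V)
  two_le_card : ∀ s ∈ edges, 2 ≤ s.nodes.card

namespace SignedHypergraph

variable {V : Type*}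

/-- The pseudo-Boolean set of `H`, in the space with one coordinate for each node (`Sum.inl`) and
one for each signed edge (`Sum.inr`). -/
def pseudoBooleanSet (H : SignedHypergraph V) : Set (V ⊕ {s // s ∈ H.edges} → ℝ) :=
  {z | (∀ i, z i = 0 ∨ z i = 1) ∧
    ∀ s : {s // s ∈ H.edges},
      z (Sum.inr s) =
        ∏ u : {u // u ∈ s.1.nodes}, SignedEdge.literal (s.1.sign u) (z (Sum.inl u.1))}

/-- The pseudo-Boolean polytope of `H`. -/
def pseudoBooleanPolytope (H : SignedHypergraph V) : Set (V ⊕ {s // s ∈ H.edges} → ℝ) :=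
  convexHull ℝ H.pseudoBooleanSet

/-- The set of underlying edges of `H`. -/
def underlyingEdges [DecidableEq V] (H : SignedHypergraph V) : Finset (Finset V) :=
  H.edges.image SignedEdge.nodes

/-- Let the nodes be listed as `v_1, …, v_n`. Because `Fin n` starts at `0`, the node `v_{k+1}` is
`v k`, and the set `e_k = {v_1, …, v_{k+1}}` consists of all `v i` with `i ≤ k`. -/
def initialEdge {n : ℕ} (v : Fin n ≃ V) (k : Fin n) : Finset V :=
  (Finset.Iic k).map v.toEmbedding

/-- `H` is a nested signed hypergraph with respect to the listing `v` of its nodes. -/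
structure IsNested [DecidableEq V] (H : SignedHypergraph V) {n : ℕ} (v : Fin n ≃ V) : Prop where
  /-- The underlying edges of `H` are exactly `e_1, …, e_{n-1}`. -/
  underlyingEdges_eq :
    H.underlyingEdges =
      (Finset.univ.filter fun k : Fin n => 1 ≤ k.val).image (initialEdge v)
  /-- If `s` has underlying edge `e_k`, then flipping the sign of `v_{k+1}` in `s` gives a signed
  edge of `H`. -/
  flip_mem : ∀ k : Fin n, 1 ≤ k.val → ∀ s ∈ H.edges, s.nodes = initialEdge v k →
    s.flip (v k) ∈ H.edges
  /-- If `s` has underlying edge `e_k`, then `s - v_{k+1}` is a signed edge of `H`. Here `2 ≤ k`,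
  because for `k = 1` the set `e_1` without `v_2` has only one node, so it is not an edge. -/
  erase_mem : ∀ k : Fin n, 2 ≤ k.val → ∀ s ∈ H.edges, s.nodes = initialEdge v k →
    s.erase (v k) ∈ H.edges

/-- The set `𝓔_k` of the signed edges of `H` with underlying edge `e_k`. -/
def edgesAt [DecidableEq V] (H : SignedHypergraph V) {n : ℕ} (v : Fin n ≃ V) (k : Fin n) :
    Finset {s // s ∈ H.edges} :=
  Finset.univ.filter fun s => s.1.nodes = initialEdge v k

/-- The set of the signed edges in `𝓔_k` in which `v_{k+1}` has the sign `ε`: this is `𝓔_k^+` for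
`ε = 1` and `𝓔_k^-` for `ε = -1`. -/
def signedEdgesAt [DecidableEq V] (H : SignedHypergraph V) {n : ℕ} (v : Fin n ≃ V) (k : Fin n)
    (ε : ℤˣ) : Finset {s // s ∈ H.edges} :=
  (H.edgesAt v k).filter fun s => s.1.HasSign (v k) ε

theorem nodes_eq_of_mem_signedEdgesAt [DecidableEq V] {H : SignedHypergraph V} {n : ℕ}
    {v : Fin n ≃ V} {k : Fin n} {ε : ℤˣ} {s : {s // s ∈ H.edges}}
    (hs : s ∈ H.signedEdgesAt v k ε) : s.1.nodes = initialEdge v k :=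
  (Finset.mem_filter.1 (Finset.mem_filter.1 hs).1).2

/-- The edge `ℓ(s)` of a nested signed hypergraph, for `s` in `𝓔_k^+` or `𝓔_k^-` and `k ≥ 2`. -/
def IsNested.flipEdge [DecidableEq V] {H : SignedHypergraph V} {n : ℕ} {v : Fin n ≃ V}
    (hH : H.IsNested v) {k : Fin n} (hk : 2 ≤ k.val) {ε : ℤˣ} {s : {s // s ∈ H.edges}}
    (hs : s ∈ H.signedEdgesAt v k ε) : {s // s ∈ H.edges} :=
  ⟨s.1.flip (v k),
    hH.flip_mem k (le_trans one_le_two hk) s.1 s.2 (nodes_eq_of_mem_signedEdgesAt hs)⟩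

/-- The edge `p(s)` of a nested signed hypergraph, for `s` in `𝓔_k^+` or `𝓔_k^-` and `k ≥ 2`. -/
def IsNested.parentEdge [DecidableEq V] {H : SignedHypergraph V} {n : ℕ} {v : Fin n ≃ V}
    (hH : H.IsNested v) {k : Fin n} (hk : 2 ≤ k.val) {ε : ℤˣ} {s : {s // s ∈ H.edges}}
    (hs : s ∈ H.signedEdgesAt v k ε) : {s // s ∈ H.edges} :=
  ⟨s.1.erase (v k), hH.erase_mem k hk s.1 s.2 (nodes_eq_of_mem_signedEdgesAt hs)⟩

end SignedHypergraph

/-! A point lies in the polytope iff it lists the node and edge marginals of a probability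
distribution on 0-1 assignments. The constraints are necessary because they are convex and hold at
every assignment: signed edges on one node set exclude each other, and `s`, `ℓ(s)` partition the
event `p(s)`.

Conversely, a distribution is built node by node. Its values on the first two nodes have weights
`z_{q_i}`. To add `v_{k+1}`, set it to true with a probability `f` depending on the earlier nodes.
The events `p(s)`, `s ∈ 𝓔_k^+`, are disjoint with masses `z_s + z_{ℓ(s)}`; `f` must carry mass `z_s`
on each and `z_{v_{k+1}}` in total. Off all the events `f` is a constant, and the two sum
inequalities say exactly that this constant can be chosen in `[0,1]`
(`exists_conditional_probability`). Resampling preserves the earlier marginals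
(`Represents.exists_succ`). -/

/-- The sign of the literals that a truth value satisfies. -/
def signOfBool (b : Bool) : ℤˣ := if b then 1 else -1

/-- The real number `0` or `1` given by a truth value. -/
def realOfBool (b : Bool) : ℝ := if b then 1 else 0

theorem signOfBool_injective : Function.Injective signOfBool := by
  intro a b; cases a <;> cases b <;> simp [signOfBool]

theorem exists_signOfBool_eq (ε : ℤˣ) : ∃ b, signOfBool b = ε := by
  rcases Int.units_eq_one_or ε with rfl | rfl
  · exact ⟨true, rfl⟩
  · exact ⟨false, rfl⟩

/-! ### Signed edges as events on assignments -/

namespace SignedEdge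

variable {V : Type*}

/-- The assignment `x` satisfies all literals of the signed edge `s`. -/
def Sat (s : SignedEdge V) (x : V → Bool) : Prop :=
  ∀ u (h : u ∈ s.nodes), s.sign ⟨u, h⟩ = signOfBool (x u)

open Classical in
/-- The indicator function of the assignments that satisfy `s`. -/
noncomputable def ind (s : SignedEdge V) (x : V → Bool) : ℝ := if s.Sat x then 1 else 0

theorem ind_eq_ite {s : SignedEdge V} {x : V → Bool} {p : Prop} [Decidable p]
    (h : s.Sat x ↔ p) : s.ind x = if p then 1 else 0 := by
  simp only [ind, h]

theorem ind_congr {s t : SignedEdge V} {x y : V → Bool} (h : s.Sat x ↔ t.Sat y) :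
    s.ind x = t.ind y := by
  classical exact (ind_eq_ite h).trans (ind_eq_ite Iff.rfl).symm

theorem ind_nonneg (s : SignedEdge V) (x : V → Bool) : 0 ≤ s.ind x := by
  unfold ind; split_ifs <;> norm_num

theorem ind_eq_zero_or_one (s : SignedEdge V) (x : V → Bool) : s.ind x = 0 ∨ s.ind x = 1 := by
  unfold ind; split_ifs <;> simp

theorem sat_of_ind_ne_zero {s : SignedEdge V} {x : V → Bool} (h : s.ind x ≠ 0) : s.Sat x := by
  by_contra hs; exact h (if_neg hs)

theorem literal_signOfBool (ε : ℤˣ) (b : Bool) :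
    literal ε (realOfBool b) = if ε = signOfBool b then 1 else 0 := by
  rcases Int.units_eq_one_or ε with rfl | rfl <;> cases b <;>
    simp [literal, realOfBool, signOfBool]

theorem prod_literal_eq_ind (s : SignedEdge V) (x : V → Bool) :
    ∏ u : {u // u ∈ s.nodes}, literal (s.sign u) (realOfBool (x u.1)) = s.ind x := by
  classical
  simp only [literal_signOfBool, Finset.prod_ite_zero, Finset.prod_const_one]
  exact (ind_eq_ite (by simp [Sat])).symm

theorem Sat.unique {s t : SignedEdge V} {x : V → Bool} (hs : s.Sat x) (ht : t.Sat x)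
    (h : s.nodes = t.nodes) : s = t := by
  obtain ⟨N, σ⟩ := s
  obtain ⟨M, τ⟩ := t
  obtain rfl : N = M := h
  congr 1
  funext ⟨u, hu⟩
  exact (hs u hu).trans (ht u hu).symm

theorem sat_congr {s : SignedEdge V} {x y : V → Bool} (h : ∀ u ∈ s.nodes, x u = y u) :
    s.Sat x ↔ s.Sat y :=
  forall₂_congr fun u hu => by rw [h u hu]

theorem HasSign.unique {s : SignedEdge V} {u : V} {ε δ : ℤˣ} (h : s.HasSign u ε)
    (h' : s.HasSign u δ) : ε = δ := by
  obtain ⟨_, rfl⟩ := h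
  obtain ⟨_, rfl⟩ := h'
  rfl

/-- An assignment that satisfies `s`. -/
noncomputable def witness (s : SignedEdge V) (u : V) : Bool :=
  open Classical in decide (s.HasSign u 1)

theorem sat_witness (s : SignedEdge V) : s.Sat s.witness := by
  classical
  intro u hu
  rcases Int.units_eq_one_or (s.sign ⟨u, hu⟩) with h | h
  · have : s.HasSign u 1 := ⟨hu, h⟩
    simp [witness, this, signOfBool, h]
  · have : ¬ s.HasSign u 1 := fun h' => absurd (h'.unique ⟨hu, h⟩) (by decide)
    simp [witness, this, signOfBool, h]

theorem ind_witness {s t : SignedEdge V} [Decidable (s = t)] (h : s.nodes = t.nodes) :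
    s.ind t.witness = if s = t then 1 else 0 := by
  refine ind_eq_ite ⟨fun hs => hs.unique t.sat_witness h, ?_⟩
  rintro rfl; exact s.sat_witness

theorem realOfBool_witness {s : SignedEdge V} {u : V} {b : Bool}
    (h : s.HasSign u (signOfBool b)) : realOfBool (s.witness u) = realOfBool b := by
  obtain ⟨hu, h⟩ := h
  rw [signOfBool_injective (h.symm.trans (s.sat_witness u hu))]

variable [DecidableEq V]

theorem sat_iff_erase {s : SignedEdge V} {u : V} (hu : u ∈ s.nodes) {x : V → Bool} :
    s.Sat x ↔ (s.erase u).Sat x ∧ s.HasSign u (signOfBool (x u)) := by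
  constructor
  · exact fun h => ⟨fun w hw => h w (Finset.mem_of_mem_erase hw), hu, h u hu⟩
  · rintro ⟨h, _, h'⟩ w hw
    by_cases hwu : w = u
    · subst hwu; exact h'
    · exact h w (Finset.mem_erase.2 ⟨hwu, hw⟩)

theorem sat_update_iff {s : SignedEdge V} {u : V} (hu : u ∈ s.nodes) {x : V → Bool} {b : Bool} :
    s.Sat (Function.update x u b) ↔ (s.erase u).Sat x ∧ s.HasSign u (signOfBool b) := by
  rw [sat_iff_erase hu, Function.update_self]
  refine and_congr_left' (sat_congr fun w hw => ?_)
  exact Function.update_of_ne (Finset.ne_of_mem_erase hw) _ _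

theorem ind_update_of_hasSign {s : SignedEdge V} {u : V} {b : Bool}
    (h : s.HasSign u (signOfBool b)) (x : V → Bool) :
    s.ind (Function.update x u b) = (s.erase u).ind x :=
  ind_congr ((sat_update_iff h.1).trans (and_iff_left h))

theorem ind_update_of_hasSign_ne {s : SignedEdge V} {u : V} {b c : Bool}
    (h : s.HasSign u (signOfBool b)) (hbc : c ≠ b) (x : V → Bool) :
    s.ind (Function.update x u c) = 0 := by
  unfold ind
  refine if_neg fun hs => hbc ?_
  exact signOfBool_injective (((sat_update_iff h.1).1 hs).2.unique h)

theorem ind_update_of_notMem {s : SignedEdge V} {u : V} (hu : u ∉ s.nodes) (x : V → Bool)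
    (b : Bool) : s.ind (Function.update x u b) = s.ind x := by
  refine ind_congr (sat_congr fun w hw => ?_)
  exact Function.update_of_ne (by rintro rfl; exact hu hw) _ _

theorem HasSign.flip {s : SignedEdge V} {u : V} {ε : ℤˣ} (h : s.HasSign u ε) :
    (s.flip u).HasSign u (-ε) := by
  obtain ⟨hu, rfl⟩ := h
  exact ⟨hu, if_pos rfl⟩

theorem flip_flip (s : SignedEdge V) (u : V) : (s.flip u).flip u = s := by
  obtain ⟨N, σ⟩ := s
  unfold SignedEdge.flip
  congr 1
  funext w
  dsimp only
  split_ifs <;> simp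

theorem erase_flip (s : SignedEdge V) (u : V) : (s.flip u).erase u = s.erase u := by
  obtain ⟨N, σ⟩ := s
  unfold SignedEdge.flip SignedEdge.erase
  congr 1
  funext w
  exact if_neg (Finset.ne_of_mem_erase w.2)

/-- Giving `u` the common sign turns `x` into an assignment satisfying both edges. Hence the events
`p(s)`, `s ∈ 𝓔_k^+`, are disjoint. -/
theorem eq_of_ind_erase_ne_zero {s t : SignedEdge V} {u : V} {ε : ℤˣ} (hs : s.HasSign u ε)
    (ht : t.HasSign u ε) (hst : s.nodes = t.nodes) {x : V → Bool}
    (hsx : (s.erase u).ind x ≠ 0) (htx : (t.erase u).ind x ≠ 0) : s = t := by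
  obtain ⟨b, rfl⟩ := exists_signOfBool_eq ε
  rw [← ind_update_of_hasSign hs] at hsx
  rw [← ind_update_of_hasSign ht] at htx
  exact (sat_of_ind_ne_zero hsx).unique (sat_of_ind_ne_zero htx) hst

theorem ind_add_ind_flip {s : SignedEdge V} {u : V} (h : u ∈ s.nodes) (x : V → Bool) :
    s.ind x + (s.flip u).ind x = (s.erase u).ind x := by
  obtain ⟨b, hb⟩ := exists_signOfBool_eq (s.sign ⟨u, h⟩)
  have hs : s.HasSign u (signOfBool b) := ⟨h, hb.symm⟩
  have hf : (s.flip u).HasSign u (signOfBool !b) := by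
    have h' := hs.flip
    cases b <;> simpa [signOfBool] using h'
  -- Viewing `x` as its own update makes the update lemmas apply to it.
  have hx : Function.update x u (x u) = x := Function.update_eq_self u x
  by_cases hxb : x u = b
  · have h1 := ind_update_of_hasSign hs x
    have h2 := ind_update_of_hasSign_ne hf (c := b) (by cases b <;> simp) x
    rw [← hxb, hx] at h1 h2
    rw [h1, h2, add_zero]
  · have hxb' : x u = !b := by cases hb' : x u <;> cases b <;> simp_all
    have h1 := ind_update_of_hasSign_ne hs (c := !b) (by cases b <;> simp) x
    have h2 := ind_update_of_hasSign hf x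
    rw [← hxb', hx] at h1 h2
    rw [h1, h2, zero_add, erase_flip]

end SignedEdge

/-! ### Conditional probabilities and resampling -/

/-- A family of `0`-`1` values of which at most one is nonzero has sum `0` or `1`. -/
theorem Finset.sum_le_one_of_disjoint {ι : Type*} {F : Finset ι} {a : ι → ℝ}
    (h01 : ∀ i ∈ F, a i = 0 ∨ a i = 1) (hd : ∀ i ∈ F, ∀ j ∈ F, a i ≠ 0 → a j ≠ 0 → i = j) :
    ∑ i ∈ F, a i ≤ 1 := by
  by_cases h : ∃ i ∈ F, a i ≠ 0
  · obtain ⟨i, hi, hai⟩ := h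
    rw [Finset.sum_eq_single_of_mem i hi fun j hj hji => by
      by_contra hj0; exact hji (hd j hj i hi hj0 hai)]
    rcases h01 i hi with h | h <;> simp [h]
  · push Not at h
    rw [Finset.sum_eq_zero h]; exact zero_le_one

/-- Let `L` be a normalized linear functional and let `A i` be the indicator functions of
pairwise disjoint events. Then there is a function with values in the unit interval that has
prescribed mass `y i` on every event and prescribed total mass `t`, as soon as the obvious
necessary conditions hold. -/
theorem exists_conditional_probability {X ι : Type*} (L : (X → ℝ) →ₗ[ℝ] ℝ)
    (hL1 : L (fun _ => 1) = 1)
    (F : Finset ι) (A : ι → X → ℝ) (h01 : ∀ i ∈ F, ∀ x, A i x = 0 ∨ A i x = 1)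
    (hd : ∀ x, ∀ i ∈ F, ∀ j ∈ F, A i x ≠ 0 → A j x ≠ 0 → i = j)
    (y : ι → ℝ) (hy0 : ∀ i ∈ F, 0 ≤ y i) (hyA : ∀ i ∈ F, y i ≤ L (A i)) (t : ℝ)
    (ht : ∑ i ∈ F, y i ≤ t) (ht' : ∑ i ∈ F, (L (A i) - y i) ≤ 1 - t) :
    ∃ f : X → ℝ, (∀ x, 0 ≤ f x) ∧ (∀ x, f x ≤ 1) ∧
      (∀ i ∈ F, L (f * A i) = y i) ∧ L f = t := by
  rw [Finset.sum_sub_distrib] at ht'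
  -- `R` is the mass outside all events; the constant `ρ` there must supply the remaining `t - ∑ y
  -- i`. Adding `ht` and `ht'` gives `0 ≤ R`, and `ht'` alone gives `ρ ≤ 1`.
  set R : ℝ := 1 - ∑ i ∈ F, L (A i) with hR
  set ρ : ℝ := (t - ∑ i ∈ F, y i) / R with hρ
  have hR0 : 0 ≤ R := by linarith
  have hρ0 : 0 ≤ ρ := div_nonneg (by linarith) hR0
  have hρ1 : ρ ≤ 1 := div_le_one_of_le₀ (by linarith) hR0
  -- If `R = 0`, the two bounds force `t = ∑ y i`, so division by zero is harmless; likewise `L (A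
  -- i) = 0` forces `y i = 0` below.
  have hρR : ρ * R = t - ∑ i ∈ F, y i :=
    div_mul_cancel_of_imp fun h => by linarith
  have hc0 : ∀ i ∈ F, 0 ≤ y i / L (A i) := fun i hi =>
    div_nonneg (hy0 i hi) ((hy0 i hi).trans (hyA i hi))
  have hc1 : ∀ i ∈ F, y i / L (A i) ≤ 1 := fun i hi =>
    div_le_one_of_le₀ (hyA i hi) ((hy0 i hi).trans (hyA i hi))
  have hcA : ∀ i ∈ F, y i / L (A i) * L (A i) = y i := fun i hi =>
    div_mul_cancel_of_imp fun h => le_antisymm (h ▸ hyA i hi) (hy0 i hi)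
  set f : X → ℝ := ∑ i ∈ F, (y i / L (A i)) • A i + ρ • ((fun _ => 1) - ∑ i ∈ F, A i) with hf
  have hfx : ∀ x, f x = ∑ i ∈ F, y i / L (A i) * A i x + ρ * (1 - ∑ i ∈ F, A i x) := by
    intro x; simp [hf, Finset.sum_apply]
  have hfi : ∀ x, ∀ i ∈ F, A i x ≠ 0 → f x = y i / L (A i) := by
    intro x i hi hix
    have hzero : ∀ j ∈ F, j ≠ i → A j x = 0 := fun j hj hji => by
      by_contra hj0; exact hji (hd x j hj i hi hj0 hix)
    rw [hfx, Finset.sum_eq_single_of_mem i hi fun j hj hji => by rw [hzero j hj hji, mul_zero],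
      Finset.sum_eq_single_of_mem i hi hzero, (h01 i hi x).resolve_left hix]
    ring
  have hfn : ∀ x, (∀ i ∈ F, A i x = 0) → f x = ρ := by
    intro x hx
    rw [hfx, Finset.sum_eq_zero fun i hi => by rw [hx i hi, mul_zero], Finset.sum_eq_zero hx]
    ring
  refine ⟨f, fun x => ?_, fun x => ?_, fun i hi => ?_, ?_⟩
  · by_cases h : ∀ i ∈ F, A i x = 0
    · rwa [hfn x h]
    · push Not at h
      obtain ⟨i, hi, hix⟩ := h
      rw [hfi x i hi hix]; exact hc0 i hi
  · by_cases h : ∀ i ∈ F, A i x = 0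
    · rwa [hfn x h]
    · push Not at h
      obtain ⟨i, hi, hix⟩ := h
      rw [hfi x i hi hix]; exact hc1 i hi
  · have : f * A i = (y i / L (A i)) • A i := by
      funext x
      by_cases hix : A i x = 0
      · simp [hix]
      · simp [hfi x i hi hix]
    rw [this, map_smul, smul_eq_mul, hcA i hi]
  · rw [hf, map_add, map_sum, map_smul, map_sub, map_sum, hL1, smul_eq_mul, ← hR, hρR,
      Finset.sum_congr rfl fun i hi => by rw [map_smul, smul_eq_mul, hcA i hi]]
    ring

/-- Resample the coordinate `u`: given the other coordinates, it is true with probability `f`. -/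
def resample {V : Type*} [DecidableEq V] (u : V) (f : (V → Bool) → ℝ) :
    ((V → Bool) → ℝ) →ₗ[ℝ] ((V → Bool) → ℝ) where
  toFun g x := f x * g (Function.update x u true) + (1 - f x) * g (Function.update x u false)
  map_add' g h := by funext x; simp only [Pi.add_apply]; ring
  map_smul' c g := by
    funext x; simp only [Pi.smul_apply, smul_eq_mul, RingHom.id_apply]; ring

theorem resample_apply {V : Type*} [DecidableEq V] (u : V) (f g : (V → Bool) → ℝ)
    (x : V → Bool) : resample u f g x =
      f x * g (Function.update x u true) + (1 - f x) * g (Function.update x u false) := rfl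

theorem resample_eq_self {V : Type*} [DecidableEq V] {u : V} (f : (V → Bool) → ℝ)
    {g : (V → Bool) → ℝ} (hg : ∀ x b, g (Function.update x u b) = g x) :
    resample u f g = g := by
  funext x; rw [resample_apply, hg, hg]; ring

/-! ### Vertices of the polytope and nested edges -/

namespace SignedHypergraph

variable {V : Type*}

theorem mem_initialEdge {n : ℕ} {v : Fin n ≃ V} {j k : Fin n} :
    v j ∈ initialEdge v k ↔ j ≤ k := by
  simp [initialEdge]

/-- The point of the pseudo-Boolean set given by an assignment of the nodes. -/
noncomputable def point (H : SignedHypergraph V) (x : V → Bool) :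
    V ⊕ {s // s ∈ H.edges} → ℝ :=
  Sum.elim (fun u => realOfBool (x u)) (fun s => s.1.ind x)

theorem point_mem (H : SignedHypergraph V) (x : V → Bool) : H.point x ∈ H.pseudoBooleanSet := by
  refine ⟨?_, fun s => (s.1.prod_literal_eq_ind x).symm⟩
  rintro (u | s)
  · cases h : x u <;> simp [point, realOfBool, h]
  · exact s.1.ind_eq_zero_or_one x

theorem exists_point_eq {H : SignedHypergraph V} {z : V ⊕ {s // s ∈ H.edges} → ℝ}
    (hz : z ∈ H.pseudoBooleanSet) : ∃ x, H.point x = z := by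
  classical
  have hx : ∀ u, realOfBool (decide (z (Sum.inl u) = 1)) = z (Sum.inl u) := by
    intro u
    rcases hz.1 (Sum.inl u) with h | h <;> simp [h, realOfBool]
  refine ⟨fun u => decide (z (Sum.inl u) = 1), funext ?_⟩
  rintro (u | s)
  · exact hx u
  · rw [hz.2 s]
    refine (s.1.prod_literal_eq_ind _).symm.trans ?_
    simp only [hx]

/-- A signed edge on the first two nodes is satisfied when both nodes have the right value. -/
theorem ind_eq_ite_of_hasSign {n : ℕ} {v : Fin n ≃ V} {i j : Fin n} (hi : i.val = 0)
    (hj : j.val = 1) {s : SignedEdge V} {a b : Bool} {x : V → Bool}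
    (hs : s.nodes = initialEdge v j) (ha : s.HasSign (v i) (signOfBool a))
    (hb : s.HasSign (v j) (signOfBool b)) :
    s.ind x = if x (v i) = a ∧ x (v j) = b then 1 else 0 := by
  refine SignedEdge.ind_eq_ite ⟨fun h => ?_, ?_⟩
  · exact ⟨signOfBool_injective ((h _ ha.1).symm.trans ha.2),
      signOfBool_injective ((h _ hb.1).symm.trans hb.2)⟩
  · rintro ⟨rfl, rfl⟩ u hu
    obtain ⟨k, rfl⟩ := v.surjective u
    have hk : k ≤ j := mem_initialEdge.1 (hs ▸ hu)
    obtain rfl | rfl : k = i ∨ k = j := by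
      simp only [Fin.ext_iff, Fin.le_def] at hk ⊢; omega
    · exact ha.2
    · exact hb.2

theorem ne_of_hasSign {H : SignedHypergraph V} {s t : {s // s ∈ H.edges}} {u : V}
    (hs : s.1.HasSign u 1) (ht : t.1.HasSign u (-1)) : s ≠ t := by
  rintro rfl; exact absurd (hs.unique ht) (by decide)

variable [DecidableEq V]

theorem mem_edgesAt {H : SignedHypergraph V} {n : ℕ} {v : Fin n ≃ V} {k : Fin n}
    {s : {s // s ∈ H.edges}} : s ∈ H.edgesAt v k ↔ s.1.nodes = initialEdge v k := by
  simp [edgesAt]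

theorem mem_signedEdgesAt {H : SignedHypergraph V} {n : ℕ} {v : Fin n ≃ V} {k : Fin n}
    {ε : ℤˣ} {s : {s // s ∈ H.edges}} :
    s ∈ H.signedEdgesAt v k ε ↔ s.1.nodes = initialEdge v k ∧ s.1.HasSign (v k) ε := by
  simp [signedEdgesAt, mem_edgesAt]

theorem IsNested.exists_nodes_eq {H : SignedHypergraph V} {n : ℕ} {v : Fin n ≃ V}
    (hH : H.IsNested v) (s : {s // s ∈ H.edges}) :
    ∃ k : Fin n, 1 ≤ k.val ∧ s.1.nodes = initialEdge v k := by
  have h : s.1.nodes ∈ H.underlyingEdges := Finset.mem_image_of_mem _ s.2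
  rw [hH.underlyingEdges_eq] at h
  obtain ⟨k, hk, h⟩ := Finset.mem_image.1 h
  exact ⟨k, (Finset.mem_filter.1 hk).2, h.symm⟩

theorem erase_nodes_eq {n : ℕ} {v : Fin n ≃ V} {j k : Fin n} (hjk : j.val + 1 = k.val)
    {s : SignedEdge V} (hs : s.nodes = initialEdge v k) :
    (s.erase (v k)).nodes = initialEdge v j := by
  ext u
  obtain ⟨i, rfl⟩ := v.surjective u
  simp only [SignedEdge.erase, hs, Finset.mem_erase, mem_initialEdge, ne_eq,
    EmbeddingLike.apply_eq_iff_eq, Fin.ext_iff, Fin.le_def]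
  omega

theorem IsNested.flipEdge_mem {H : SignedHypergraph V} {n : ℕ} {v : Fin n ≃ V}
    (hH : H.IsNested v) {k : Fin n} (hk : 2 ≤ k.val) {ε : ℤˣ} {s : {s // s ∈ H.edges}}
    (hs : s ∈ H.signedEdgesAt v k ε) : hH.flipEdge hk hs ∈ H.signedEdgesAt v k (-ε) :=
  mem_signedEdgesAt.2 ⟨(mem_signedEdgesAt.1 hs).1, (mem_signedEdgesAt.1 hs).2.flip⟩

theorem IsNested.flipEdge_surjective {H : SignedHypergraph V} {n : ℕ} {v : Fin n ≃ V}
    (hH : H.IsNested v) {k : Fin n} (hk : 2 ≤ k.val) {ε : ℤˣ} {s : {s // s ∈ H.edges}}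
    (hs : s ∈ H.signedEdgesAt v k (-ε)) :
    ∃ (t : {s // s ∈ H.edges}) (ht : t ∈ H.signedEdgesAt v k ε), hH.flipEdge hk ht = s := by
  refine ⟨hH.flipEdge hk hs, by simpa using hH.flipEdge_mem hk hs, Subtype.ext ?_⟩
  exact s.1.flip_flip (v k)

theorem IsNested.flipEdge_injective {H : SignedHypergraph V} {n : ℕ} {v : Fin n ≃ V}
    (hH : H.IsNested v) {k : Fin n} (hk : 2 ≤ k.val) {ε : ℤˣ} {s t : {s // s ∈ H.edges}}
    (hs : s ∈ H.signedEdgesAt v k ε) (ht : t ∈ H.signedEdgesAt v k ε)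
    (h : hH.flipEdge hk hs = hH.flipEdge hk ht) : s = t := by
  refine Subtype.ext ?_
  rw [← s.1.flip_flip (v k), ← t.1.flip_flip (v k)]
  exact congrArg (fun e => e.1.flip (v k)) h

/-- At most one of the signed edges with a given sign at `v k` is satisfied by `x`, and only if
`x` gives `v k` that sign. -/
theorem sum_ind_le (H : SignedHypergraph V) {n : ℕ} (v : Fin n ≃ V) (k : Fin n) (b : Bool)
    (x : V → Bool) :
    ∑ s ∈ H.signedEdgesAt v k (signOfBool b), s.1.ind x ≤ if x (v k) = b then 1 else 0 := by
  split_ifs with h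
  · refine Finset.sum_le_one_of_disjoint (fun s _ => s.1.ind_eq_zero_or_one x) ?_
    intro s hs t ht hsx htx
    refine Subtype.ext ((SignedEdge.sat_of_ind_ne_zero hsx).unique
      (SignedEdge.sat_of_ind_ne_zero htx) ?_)
    rw [(mem_signedEdgesAt.1 hs).1, (mem_signedEdgesAt.1 ht).1]
  · refine (Finset.sum_eq_zero fun s hs => ?_).le
    have := SignedEdge.ind_update_of_hasSign_ne (mem_signedEdgesAt.1 hs).2 h x
    rwa [Function.update_eq_self] at this

/-! ### Distributions with prescribed marginals -/

/-- The distribution `L` on the assignments has the marginals that `z` prescribes for the nodes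
`v 0, …, v k` and for the signed edges on them. -/
structure Represents (H : SignedHypergraph V) {n : ℕ} (v : Fin n ≃ V)
    (z : V ⊕ {s // s ∈ H.edges} → ℝ) (k : ℕ) (L : ((V → Bool) → ℝ) →ₗ[ℝ] ℝ) : Prop where
  nonneg : ∀ g : (V → Bool) → ℝ, (∀ x, 0 ≤ g x) → 0 ≤ L g
  map_one : L (fun _ => 1) = 1
  map_node : ∀ j : Fin n, j.val ≤ k → L (fun x => realOfBool (x (v j))) = z (Sum.inl (v j))
  map_edge : ∀ (s : {s // s ∈ H.edges}) (j : Fin n), 1 ≤ j.val → j.val ≤ k →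
    s.1.nodes = initialEdge v j → L s.1.ind = z (Sum.inr s)

/-- The values of `L` on point masses are convex weights, and `z` is the corresponding average of
the vertices. -/
theorem Represents.mem_pseudoBooleanPolytope {H : SignedHypergraph V} {n : ℕ} {v : Fin n ≃ V}
    (hH : H.IsNested v) {z : V ⊕ {s // s ∈ H.edges} → ℝ} {k : ℕ} (hk : n ≤ k + 1)
    {L : ((V → Bool) → ℝ) →ₗ[ℝ] ℝ} (hL : H.Represents v z k L) :
    z ∈ H.pseudoBooleanPolytope := by
  classical
  have : Fintype V := Fintype.ofEquiv _ v
  have hsum : ∀ g, ∑ x, L (Pi.single x 1) * g x = L g := by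
    intro g
    rw [L.pi_apply_eq_sum_univ g]
    refine Finset.sum_congr rfl fun x _ => ?_
    rw [smul_eq_mul, mul_comm]
    congr 2
    funext y
    simp [Pi.single_apply, eq_comm]
  have hz : ∑ x, L (Pi.single x 1) • H.point x = z := by
    funext i
    rw [Finset.sum_apply]
    simp only [Pi.smul_apply, smul_eq_mul]
    rw [hsum fun x => H.point x i]
    rcases i with u | s
    · obtain ⟨j, rfl⟩ := v.surjective u
      exact hL.map_node j (by omega)
    · obtain ⟨j, hj, hs⟩ := hH.exists_nodes_eq s
      exact hL.map_edge s j hj (by omega) hs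
  rw [← hz]
  refine (convex_convexHull ℝ _).sum_mem (fun x _ => hL.nonneg _ fun y => ?_) ?_
    fun x _ => subset_convexHull ℝ _ (H.point_mem x)
  · rw [Pi.single_apply]; split_ifs <;> norm_num
  · simpa [hL.map_one] using hsum fun _ => 1

theorem Represents.exists_succ {H : SignedHypergraph V} {n : ℕ} {v : Fin n ≃ V}
    (hH : H.IsNested v) {z : V ⊕ {s // s ∈ H.edges} → ℝ} {j k : Fin n} (hj : 1 ≤ j.val)
    (hjk : j.val + 1 = k.val) (hk : 2 ≤ k.val)
    (hp : ∀ (s : {s // s ∈ H.edges}) (hs : s ∈ H.signedEdgesAt v k 1),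
      z (Sum.inr s) + z (Sum.inr (hH.flipEdge hk hs)) = z (Sum.inr (hH.parentEdge hk hs)))
    (h0 : ∀ s : {s // s ∈ H.edges}, 0 ≤ z (Sum.inr s))
    (hpos : ∑ s ∈ H.signedEdgesAt v k 1, z (Sum.inr s) ≤ z (Sum.inl (v k)))
    (hneg : ∑ s ∈ H.signedEdgesAt v k (-1), z (Sum.inr s) ≤ 1 - z (Sum.inl (v k)))
    {L : ((V → Bool) → ℝ) →ₗ[ℝ] ℝ} (hL : H.Represents v z j L) :
    ∃ L', H.Represents v z k L' := by
  have hA : ∀ (s : {s // s ∈ H.edges}) (hs : s ∈ H.signedEdgesAt v k 1),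
      L (s.1.erase (v k)).ind = z (Sum.inr s) + z (Sum.inr (hH.flipEdge hk hs)) := by
    intro s hs
    rw [hp s hs]
    exact hL.map_edge (hH.parentEdge hk hs) j hj le_rfl
      (erase_nodes_eq hjk (mem_signedEdgesAt.1 hs).1)
  obtain ⟨f, hf0, hf1, hfA, hft⟩ := exists_conditional_probability L hL.map_one
    (H.signedEdgesAt v k 1) (fun s => (s.1.erase (v k)).ind)
    (fun s _ x => SignedEdge.ind_eq_zero_or_one _ x)
    (fun x s hs t ht hsx htx => Subtype.ext (SignedEdge.eq_of_ind_erase_ne_zero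
      (mem_signedEdgesAt.1 hs).2 (mem_signedEdgesAt.1 ht).2
      ((mem_signedEdgesAt.1 hs).1.trans (mem_signedEdgesAt.1 ht).1.symm) hsx htx))
    (fun s => z (Sum.inr s)) (fun s _ => h0 s)
    (fun s hs => by rw [hA s hs]; linarith [h0 (hH.flipEdge hk hs)])
    (z (Sum.inl (v k))) hpos (by
      -- The defects `L(p(s)) - z_s` equal `z_{ℓ(s)}`, and `ℓ` is a bijection from `𝓔_k^+` to
      -- `𝓔_k^-`.
      refine le_of_eq_of_le ?_ hneg
      refine Finset.sum_bij (fun s hs => hH.flipEdge hk hs) (fun s hs => hH.flipEdge_mem hk hs)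
        (fun s hs t ht => hH.flipEdge_injective hk hs ht)
        (fun s hs => hH.flipEdge_surjective hk hs) fun s hs => ?_
      rw [hA s hs]; ring)
  refine ⟨L ∘ₗ resample (v k) f, ?_, ?_, ?_, ?_⟩
  · intro g hg
    refine hL.nonneg _ fun x => ?_
    exact add_nonneg (mul_nonneg (hf0 x) (hg _)) (mul_nonneg (sub_nonneg.2 (hf1 x)) (hg _))
  · rw [LinearMap.comp_apply, resample_eq_self f fun _ _ => rfl, hL.map_one]
  · intro i hi
    rw [LinearMap.comp_apply]
    by_cases hik : i = k
    · subst hik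
      rw [← hft]
      congr 1
      funext x
      simp [resample_apply, realOfBool]
    · rw [resample_eq_self f, hL.map_node i (by have := Fin.val_ne_of_ne hik; omega)]
      intro x b
      rw [Function.update_of_ne (v.injective.ne hik)]
  · intro s i hi hik hs
    rw [LinearMap.comp_apply]
    by_cases h : i = k
    · subst h
      have hmem : v i ∈ s.1.nodes := hs ▸ mem_initialEdge.2 le_rfl
      rcases Int.units_eq_one_or (s.1.sign ⟨v i, hmem⟩) with h | h
      · have hsg : s.1.HasSign (v i) (signOfBool true) := ⟨hmem, h⟩
        rw [← hfA s (mem_signedEdgesAt.2 ⟨hs, hsg⟩)]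
        congr 1
        funext x
        rw [resample_apply, SignedEdge.ind_update_of_hasSign hsg,
          SignedEdge.ind_update_of_hasSign_ne hsg (by simp)]
        simp
      · have hsg : s.1.HasSign (v i) (signOfBool false) := ⟨hmem, h⟩
        -- A negative edge is `ℓ(t)`, so it receives the mass of `p(t)` not given to `t`.
        obtain ⟨t, ht, rfl⟩ := hH.flipEdge_surjective hk (mem_signedEdgesAt.2 ⟨hs, hsg⟩)
        have : resample (v i) f (hH.flipEdge hk ht).1.ind =
            (t.1.erase (v i)).ind - f * (t.1.erase (v i)).ind := by
          funext x
          rw [resample_apply, SignedEdge.ind_update_of_hasSign hsg,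
            SignedEdge.ind_update_of_hasSign_ne hsg (by simp)]
          simp only [IsNested.flipEdge, SignedEdge.erase_flip, Pi.sub_apply, Pi.mul_apply]
          ring
        rw [this, map_sub, hfA t ht, hA t ht]
        ring
    · rw [resample_eq_self f, hL.map_edge s i hi (by have := Fin.val_ne_of_ne h; omega) hs]
      intro x b
      refine SignedEdge.ind_update_of_notMem ?_ x b
      rw [hs, mem_initialEdge]
      exact fun h' => h (le_antisymm hik h')

theorem sum_four {α : Type*} [DecidableEq α] {E : Finset α} {a b c d : α}
    (hE : (E : Set α) = {a, b, c, d}) (hab : a ≠ b) (hac : a ≠ c) (had : a ≠ d) (hbc : b ≠ c)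
    (hbd : b ≠ d) (hcd : c ≠ d) (g : α → ℝ) :
    ∑ i ∈ E, g i = g a + g b + g c + g d := by
  have : E = {a, b, c, d} := by
    apply Finset.coe_injective; rw [hE]; simp
  rw [this, Finset.sum_insert (by simp [*]), Finset.sum_insert (by simp [*]),
    Finset.sum_pair hcd]
  ring

/-- Put mass `z_q` on one assignment satisfying `q`, for each of the four `q`; its values beyond the
first two nodes do not matter. The total mass is one by adding `h1` and `h3`. -/
theorem exists_represents_one {H : SignedHypergraph V} {n : ℕ} {v : Fin n ≃ V} {i j : Fin n}
    (hi : i.val = 0) (hj : j.val = 1) {q₁ q₂ q₃ q₄ : {s // s ∈ H.edges}}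
    (hE₁ : H.edgesAt v j = ({q₁, q₂, q₃, q₄} : Set {s // s ∈ H.edges}))
    (hq₁ : q₁.1.HasSign (v i) 1 ∧ q₁.1.HasSign (v j) 1)
    (hq₂ : q₂.1.HasSign (v i) 1 ∧ q₂.1.HasSign (v j) (-1))
    (hq₃ : q₃.1.HasSign (v i) (-1) ∧ q₃.1.HasSign (v j) 1)
    (hq₄ : q₄.1.HasSign (v i) (-1) ∧ q₄.1.HasSign (v j) (-1))
    {z : V ⊕ {s // s ∈ H.edges} → ℝ} (h0 : ∀ s : {s // s ∈ H.edges}, 0 ≤ z (Sum.inr s))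
    (h1 : z (Sum.inr q₁) + z (Sum.inr q₂) = z (Sum.inl (v i)))
    (h2 : z (Sum.inr q₁) + z (Sum.inr q₃) = z (Sum.inl (v j)))
    (h3 : z (Sum.inr q₃) + z (Sum.inr q₄) = 1 - z (Sum.inl (v i))) :
    ∃ L, H.Represents v z 1 L := by
  classical
  have hsum := sum_four hE₁ (ne_of_hasSign hq₁.2 hq₂.2) (ne_of_hasSign hq₁.1 hq₃.1)
    (ne_of_hasSign hq₁.1 hq₄.1) (ne_of_hasSign hq₂.1 hq₃.1) (ne_of_hasSign hq₂.1 hq₄.1)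
    (ne_of_hasSign hq₃.2 hq₄.2)
  let L : ((V → Bool) → ℝ) →ₗ[ℝ] ℝ :=
    ∑ s ∈ H.edgesAt v j, z (Sum.inr s) • LinearMap.proj s.1.witness
  have hL : ∀ g, L g = ∑ s ∈ H.edgesAt v j, z (Sum.inr s) * g s.1.witness := by
    intro g; simp [L, LinearMap.sum_apply]
  have hT : ∀ {s : {s // s ∈ H.edges}} {u : V}, s.1.HasSign u 1 →
      realOfBool (s.1.witness u) = 1 := fun h => SignedEdge.realOfBool_witness (b := true) h
  have hF : ∀ {s : {s // s ∈ H.edges}} {u : V}, s.1.HasSign u (-1) →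
      realOfBool (s.1.witness u) = 0 := fun h => SignedEdge.realOfBool_witness (b := false) h
  refine ⟨L, ?_, ?_, ?_, ?_⟩
  · intro g hg
    rw [hL]
    exact Finset.sum_nonneg fun s _ => mul_nonneg (h0 s) (hg _)
  · rw [hL, hsum]; linarith
  · intro k hk
    rw [hL, hsum]
    obtain rfl | rfl : k = i ∨ k = j := by simp only [Fin.ext_iff]; omega
    · rw [hT hq₁.1, hT hq₂.1, hF hq₃.1, hF hq₄.1]; linarith
    · rw [hT hq₁.2, hF hq₂.2, hT hq₃.2, hF hq₄.2]; linarith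
  · intro s k hk hk' hs
    obtain rfl : k = j := Fin.ext (by omega)
    rw [hL, Finset.sum_eq_single_of_mem s (mem_edgesAt.2 hs)]
    · rw [SignedEdge.ind_witness rfl, if_pos rfl, mul_one]
    · intro t ht hts
      rw [SignedEdge.ind_witness (hs.trans (mem_edgesAt.1 ht).symm),
        if_neg fun h => hts (Subtype.ext h.symm), mul_zero]

end SignedHypergraph

/-! ### The two inclusions -/

theorem mainTheorem6 {V : Type*} [DecidableEq V] (H : SignedHypergraph V)
    (n : ℕ) (hn : 2 ≤ n) (v : Fin n ≃ V) (hH : H.IsNested v)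
    (v₁ v₂ : V) (hv₁ : v₁ = v ⟨0, by omega⟩) (hv₂ : v₂ = v ⟨1, by omega⟩)
    (q₁ q₂ q₃ q₄ : {s // s ∈ H.edges})
    (hE₁ : H.edgesAt v ⟨1, by omega⟩ = ({q₁, q₂, q₃, q₄} : Set {s // s ∈ H.edges}))
    (hq₁ : q₁.1.HasSign v₁ 1 ∧ q₁.1.HasSign v₂ 1)
    (hq₂ : q₂.1.HasSign v₁ 1 ∧ q₂.1.HasSign v₂ (-1))
    (hq₃ : q₃.1.HasSign v₁ (-1) ∧ q₃.1.HasSign v₂ 1)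
    (hq₄ : q₄.1.HasSign v₁ (-1) ∧ q₄.1.HasSign v₂ (-1)) :
    H.pseudoBooleanPolytope =
      {z : V ⊕ {s // s ∈ H.edges} → ℝ |
        (∀ (k : Fin n) (hk : 2 ≤ k.val) (s : {s // s ∈ H.edges})
          (hs : s ∈ H.signedEdgesAt v k 1),
          z (Sum.inr s) + z (Sum.inr (hH.flipEdge hk hs)) = z (Sum.inr (hH.parentEdge hk hs))) ∧
        (∀ s : {s // s ∈ H.edges}, 0 ≤ z (Sum.inr s)) ∧
        (∀ k : Fin n, 2 ≤ k.val →
          ∑ s ∈ H.signedEdgesAt v k 1, z (Sum.inr s) ≤ z (Sum.inl (v k))) ∧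
        (∀ k : Fin n, 2 ≤ k.val →
          ∑ s ∈ H.signedEdgesAt v k (-1), z (Sum.inr s) ≤ 1 - z (Sum.inl (v k))) ∧
        z (Sum.inr q₁) + z (Sum.inr q₂) = z (Sum.inl v₁) ∧
        z (Sum.inr q₁) + z (Sum.inr q₃) = z (Sum.inl v₂) ∧
        z (Sum.inr q₃) + z (Sum.inr q₄) = 1 - z (Sum.inl v₁)} := by
  subst hv₁ hv₂
  apply Set.Subset.antisymm
  · refine convexHull_min ?_ ?_
    · intro z hz
      obtain ⟨x, rfl⟩ := SignedHypergraph.exists_point_eq hz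
      have hmem : ∀ {k : Fin n} {ε : ℤˣ} {s : {s // s ∈ H.edges}},
          s ∈ H.signedEdgesAt v k ε → v k ∈ s.1.nodes := fun hs =>
        (SignedHypergraph.mem_signedEdgesAt.1 hs).2.1
      have hq : ∀ q ∈ ({q₁, q₂, q₃, q₄} : Set {s // s ∈ H.edges}),
          q.1.nodes = SignedHypergraph.initialEdge v ⟨1, by omega⟩ := by
        intro q hq
        rw [← hE₁] at hq
        exact SignedHypergraph.mem_edgesAt.1 hq
      have e₁ := SignedHypergraph.ind_eq_ite_of_hasSign (x := x) (a := true) (b := true)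
        rfl rfl (hq q₁ (by simp)) hq₁.1 hq₁.2
      have e₂ := SignedHypergraph.ind_eq_ite_of_hasSign (x := x) (a := true) (b := false)
        rfl rfl (hq q₂ (by simp)) hq₂.1 hq₂.2
      have e₃ := SignedHypergraph.ind_eq_ite_of_hasSign (x := x) (a := false) (b := true)
        rfl rfl (hq q₃ (by simp)) hq₃.1 hq₃.2
      have e₄ := SignedHypergraph.ind_eq_ite_of_hasSign (x := x) (a := false) (b := false)
        rfl rfl (hq q₄ (by simp)) hq₄.1 hq₄.2
      refine ⟨fun k hk s hs => s.1.ind_add_ind_flip (hmem hs) x, fun s => s.1.ind_nonneg x,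
        fun k _ => ?_, fun k _ => ?_, ?_⟩
      · exact H.sum_ind_le v k true x
      · refine (H.sum_ind_le v k false x).trans ?_
        cases h : x (v k) <;> simp [SignedHypergraph.point, realOfBool, h]
      · simp only [SignedHypergraph.point, Sum.elim_inl, Sum.elim_inr, e₁, e₂, e₃, e₄]
        cases x (v ⟨0, by omega⟩) <;> cases x (v ⟨1, by omega⟩) <;> simp [realOfBool]
    · rintro y ⟨y1, y2, y3, y4, y5, y6, y7⟩ w ⟨w1, w2, w3, w4, w5, w6, w7⟩ a b ha hb hab
      simp only [Set.mem_ofPred_eq, Pi.add_apply, Pi.smul_apply, smul_eq_mul,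
        Finset.sum_add_distrib, ← Finset.mul_sum]
      -- Every constraint is affine; `a + b = 1` is needed only where the constant 1 occurs.
      refine ⟨fun k hk s hs => ?_, fun s => ?_, fun k hk => ?_, fun k hk => ?_, ?_, ?_, ?_⟩
      · linear_combination a * y1 k hk s hs + b * w1 k hk s hs
      · exact add_nonneg (mul_nonneg ha (y2 s)) (mul_nonneg hb (w2 s))
      · exact add_le_add (mul_le_mul_of_nonneg_left (y3 k hk) ha)
          (mul_le_mul_of_nonneg_left (w3 k hk) hb)
      · refine (add_le_add (mul_le_mul_of_nonneg_left (y4 k hk) ha)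
          (mul_le_mul_of_nonneg_left (w4 k hk) hb)).trans_eq ?_
        linear_combination hab
      · linear_combination a * y5 + b * w5
      · linear_combination a * y6 + b * w6
      · linear_combination a * y7 + b * w7 + hab
  · rintro z ⟨h1, h2, h3, h4, h5, h6, h7⟩
    have key : ∀ k : ℕ, 1 ≤ k → k < n → ∃ L, H.Represents v z k L := by
      intro k hk
      induction k, hk using Nat.le_induction with
      | base =>
        exact fun _ => SignedHypergraph.exists_represents_one rfl rfl hE₁ hq₁ hq₂ hq₃ hq₄ h2
          h5 h6 h7
      | succ k hk ih =>
        intro hkn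
        obtain ⟨L, hL⟩ := ih (by omega)
        have hk2 : 2 ≤ (⟨k + 1, hkn⟩ : Fin n).val := Nat.succ_le_succ hk
        exact SignedHypergraph.Represents.exists_succ hH (j := ⟨k, by omega⟩)
          (k := ⟨k + 1, hkn⟩) hk rfl hk2 (h1 _ hk2) h2 (h3 _ hk2) (h4 _ hk2) hL
    -- Indices start at 0, so level `n - 1` includes every node and edge.
    obtain ⟨L, hL⟩ := key (n - 1) (by omega) (by omega)
    exact hL.mem_pseudoBooleanPolytope hH (by omega)
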